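/- For $n\ge 0$ let the eigenvalues of the $n\times n$ Gaussian unitary ensemble have joint probability density on $\mathbb{R}^n$ $$\frac{1}{N_n}\,e^{-\sum_{j=1}^n\lambda_j^2}\prod_{1\le j<k\le n}(\lambda_j-\lambda_k)^2,\qquad N_n=\int_{\mathbb{R}^n}e^{-\sum_{j}\lambda_j^2}\prod_{1\le j<k\le n}(\lambda_j-\lambda_k)^2\,d\lambda .$$ Let $p(k,n)$ be the probability that exactly $k$ of the $n$ eigenvalues are positive, let $\langle n_+\rangle=\sum_{k=0}^n k\,p(k,n)$ be the mean of the number $n_+$ of positive eigenvalues (the index), and let $\Delta_n=\sum_{k=0}^n\left(k-\langle n_+\rangle\right)^2p(k,n)$ be its variance (so $\Delta_0=0$). For $n\ge1$ put $$e_n=n\,\Delta_{n+1}-(n+1)\Delta_n-(n-2)\Delta_{n-1}+(n-1)\Delta_{n-2},$$ where for $n=1$ the last term, having coefficient $0$, is omitted. Then $e_n$ is the inhomogeneous term of the linear difference equation $$n\,\Delta_{n+1}-(n+1)\Delta_n-(n-2)\Delta_{n-1}+(n-1)\Delta_{n-2}=\frac{1-(-1)^n}{2}\,e_n,\qquad n\ge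 2$$ (that is, the left-hand side vanishes for even $n\geq 2$), and for odd indices it is given by $$e_{2m+1}=-\frac{1}{\pi^2}\,\frac{\Gamma^2(m+\tfrac12)}{\Gamma^2(m+1)},\qquad m\ge 0 .$$ -/

import Mathlib

namespace GUEIndex

/-- The unnormalised joint eigenvalue density of the `n × n` Gaussian unitary ensemble,
`exp (-∑ⱼ xⱼ²) ∏_{j<k} (xⱼ - xₖ)²`. -/
noncomputable def weight (n : ℕ) (x : Fin n → ℝ) : ℝ :=
  Real.exp (-∑ j, x j ^ 2) * ∏ j, ∏ k ∈ Finset.Ioi j, (x j - x k) ^ 2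

/-- The normalisation `Nₙ`, the integral of `weight n` over `ℝⁿ`. -/
noncomputable def normalisation (n : ℕ) : ℝ := ∫ x : Fin n → ℝ, weight n x

/-- The number `n₊` of positive eigenvalues. -/
noncomputable def index {n : ℕ} (x : Fin n → ℝ) : ℕ :=
  (Finset.univ.filter fun j => 0 < x j).card

/-- `p(k, n)`: the probability that exactly `k` of the `n` eigenvalues are positive. -/
noncomputable def prob (k n : ℕ) : ℝ :=
  (∫ x in {x : Fin n → ℝ | index x = k}, weight n x) / normalisation n

/-- The mean `⟨n₊⟩` of the index. -/
noncomputable def mean (n : ℕ) : ℝ :=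
  ∑ k ∈ Finset.range (n + 1), (k : ℝ) * prob k n

/-- The variance `Δₙ` of the index. -/
noncomputable def variance (n : ℕ) : ℝ :=
  ∑ k ∈ Finset.range (n + 1), ((k : ℝ) - mean n) ^ 2 * prob k n

/-- The inhomogeneous term `eₙ`, for `n ≥ 1`: the value of the third order linear difference operator
on the sequence `Δ`. At `n = 1` the last term has coefficient zero, so the truncated index `n - 2` is
harmless there. -/
noncomputable def inhomogeneousTerm (n : ℕ) : ℝ :=
  (n : ℝ) * variance (n + 1) - ((n : ℝ) + 1) * variance n
    - ((n : ℝ) - 2) * variance (n - 1) + ((n : ℝ) - 1) * variance (n - 2)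

end GUEIndex

open Polynomial MeasureTheory Set Filter Topology

namespace GUEIndex

/-! The weight is a squared Vandermonde determinant, so Andréief's identity turns the generating
function of the index into `det (1 + t A)`, where `A` is multiplication by the indicator of the half
line, compressed to the first `n` Hermite functions (`sum_prob_mul_pow`). Its first two coefficients
give the variance `tr A - tr A²` (`variance_eq_trace`), hence `Δₙ₊₁ - Δₙ = 1/4 - 2 ∑_{j<n} ⟨j|A|n⟩²`
(`variance_succ`).

The off-diagonal entries are boundary values at `0` of a Wronskian. They vanish for equal parity;
for opposite parity their squares are explicit in `c_m = 4⁻ᵐ (2m choose m)` (`overlapSq_even_odd`).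
The increments thus reduce to two finite sums, `oddSum` and `evenSum`.

With `dₙ = Δₙ₊₁ - Δₙ` the difference operator is `n dₙ - dₙ₋₁ - (n - 1) dₙ₋₂`, which kills the
constant `1/4`. Its vanishing for even `n` is `oddSum_succ`; its value `-c_m²/π` for odd `n` comes
from the telescoping identity `evenSum_succ`. -/

/-! ### Monic Hermite polynomials -/

/-- The monic Hermite polynomials, orthogonal with respect to `exp (-x ^ 2)`. -/
noncomputable def monicHermite : ℕ → ℝ[X]
  | 0 => 1
  | k + 1 => X * monicHermite k - C (1 / 2) * derivative (monicHermite k)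

theorem monicHermite_zero : monicHermite 0 = 1 := rfl

theorem monicHermite_succ (k : ℕ) :
    monicHermite (k + 1) = X * monicHermite k - C (1 / 2) * derivative (monicHermite k) := rfl

theorem derivative_monicHermite_succ (k : ℕ) :
    derivative (monicHermite (k + 1)) = (k + 1 : ℝ[X]) * monicHermite k := by
  induction k with
  | zero => simp [monicHermite_succ, monicHermite_zero]
  | succ k ih =>
    rw [monicHermite_succ (k + 1)]
    simp only [derivative_sub, derivative_mul, derivative_X, derivative_C, ih]
    rw [monicHermite_succ k]
    have : derivative (k + 1 : ℝ[X]) = 0 := by simp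
    rw [this]
    push_cast
    ring

theorem derivative_derivative_monicHermite (k : ℕ) :
    derivative (derivative (monicHermite k)) =
      2 * X * derivative (monicHermite k) - 2 * (k : ℝ[X]) * monicHermite k := by
  have h := derivative_monicHermite_succ k
  rw [monicHermite_succ] at h
  simp only [derivative_sub, derivative_mul, derivative_X, derivative_C] at h
  have h2 : (C (1 / 2) : ℝ[X]) * 2 = 1 := by
    rw [show (2 : ℝ[X]) = C 2 from rfl, ← C_mul]; norm_num
  linear_combination (-2 : ℝ[X]) * h - derivative (derivative (monicHermite k)) * h2

theorem monicHermite_monic_natDegree (k : ℕ) :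
    (monicHermite k).Monic ∧ (monicHermite k).natDegree = k := by
  induction k with
  | zero => simp [monicHermite_zero]
  | succ k ih =>
    have hX : (X * monicHermite k).Monic := monic_X.mul ih.1
    have hdX : (X * monicHermite k).natDegree = k + 1 := by
      rw [natDegree_X_mul ih.1.ne_zero, ih.2]
    have hlt : (C (1 / 2) * derivative (monicHermite k)).degree < (X * monicHermite k).degree := by
      rw [degree_eq_natDegree hX.ne_zero, hdX]
      refine lt_of_le_of_lt (degree_le_natDegree) ?_
      have := (natDegree_C_mul_le (1 / 2 : ℝ) (derivative (monicHermite k))).trans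
        (natDegree_derivative_le _)
      exact_mod_cast (by omega : _ < k + 1)
    rw [monicHermite_succ]
    refine ⟨hX.sub_of_left hlt, ?_⟩
    rw [natDegree_eq_of_degree_eq (degree_sub_eq_left_of_degree_lt hlt), hdX]

theorem monicHermite_monic (k : ℕ) : (monicHermite k).Monic := (monicHermite_monic_natDegree k).1

theorem natDegree_monicHermite (k : ℕ) : (monicHermite k).natDegree = k :=
  (monicHermite_monic_natDegree k).2

/-! ### Gaussian integrals on the line and the half line -/

theorem integrable_eval_mul_exp_neg_sq (p : ℝ[X]) :
    Integrable fun x : ℝ => p.eval x * Real.exp (-x ^ 2) := by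
  induction p using Polynomial.induction_on' with
  | add p q hp hq =>
    simp only [eval_add, add_mul]
    exact hp.add hq
  | monomial n a =>
    have h := (integrable_rpow_mul_exp_neg_mul_sq one_pos (s := n)
      (by linarith [(Nat.cast_nonneg n : (0 : ℝ) ≤ n)])).const_mul a
    simpa [eval_monomial, Real.rpow_natCast, mul_assoc] using h

theorem hasDerivAt_eval_mul_exp_neg_sq (p : ℝ[X]) (x : ℝ) :
    HasDerivAt (fun x : ℝ => p.eval x * Real.exp (-x ^ 2))
      ((derivative p - 2 * X * p).eval x * Real.exp (-x ^ 2)) x := by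
  have h := (p.hasDerivAt x).mul ((hasDerivAt_pow 2 x).neg.exp)
  refine h.congr_deriv ?_
  simp only [eval_sub, eval_mul, eval_X, eval_ofNat, Nat.cast_ofNat, Pi.neg_apply]
  ring

theorem integral_derivative_sub_mul_exp_neg_sq (p : ℝ[X]) :
    ∫ x : ℝ, (derivative p - 2 * X * p).eval x * Real.exp (-x ^ 2) = 0 :=
  integral_eq_zero_of_hasDerivAt_of_integrable (hasDerivAt_eval_mul_exp_neg_sq p)
    (integrable_eval_mul_exp_neg_sq _) (integrable_eval_mul_exp_neg_sq _)

theorem integral_Ioi_derivative_sub_mul_exp_neg_sq (p : ℝ[X]) :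
    ∫ x in Ioi (0 : ℝ), (derivative p - 2 * X * p).eval x * Real.exp (-x ^ 2) = -p.eval 0 := by
  -- The primitive vanishes at infinity because it and its derivative are both integrable; no growth
  -- estimate is needed.
  rw [integral_Ioi_of_hasDerivAt_of_tendsto' (fun x _ => hasDerivAt_eval_mul_exp_neg_sq p x)
    (integrable_eval_mul_exp_neg_sq _).integrableOn
    (tendsto_zero_of_hasDerivAt_of_integrableOn_Ioi (a := 0)
      (fun x _ => hasDerivAt_eval_mul_exp_neg_sq p x)
      (integrable_eval_mul_exp_neg_sq _).integrableOn
      (integrable_eval_mul_exp_neg_sq _).integrableOn)]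
  simp

/-- By the Hermite equation the first-order terms cancel in the Wronskian. So `Hⱼ Hₖ exp (-x²)` has
an explicit primitive when `j ≠ k`, giving both orthogonality and the half-line entries. -/
theorem derivative_wronskian_monicHermite (j k : ℕ) :
    derivative (monicHermite j * derivative (monicHermite k)
        - derivative (monicHermite j) * monicHermite k)
      - 2 * X * (monicHermite j * derivative (monicHermite k)
        - derivative (monicHermite j) * monicHermite k)
      = C (2 * ((j : ℝ) - k)) * (monicHermite j * monicHermite k) := by
  simp only [derivative_sub, derivative_mul, derivative_derivative_monicHermite, C_mul, C_sub,
    C_eq_natCast, show (C 2 : ℝ[X]) = 2 from rfl]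
  ring

theorem derivative_monicHermite_mul_succ (k : ℕ) :
    derivative (monicHermite (k + 1) * monicHermite k)
      - 2 * X * (monicHermite (k + 1) * monicHermite k)
      = C ((k : ℝ) + 1) * (monicHermite k * monicHermite k)
        - C 2 * (monicHermite (k + 1) * monicHermite (k + 1)) := by
  have h2 : (C (1 / 2) : ℝ[X]) * 2 = 1 := by
    rw [show (2 : ℝ[X]) = C 2 from rfl, ← C_mul]; norm_num
  rw [derivative_mul, derivative_monicHermite_succ]
  simp only [C_add, C_1, C_eq_natCast, show (C 2 : ℝ[X]) = 2 from rfl]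
  linear_combination 2 * monicHermite (k + 1) * monicHermite_succ k
    - (monicHermite (k + 1) * derivative (monicHermite k)) * h2

/-- The inner products of the monic Hermite polynomials on the whole line. -/
noncomputable def fullMoment (j k : ℕ) : ℝ :=
  ∫ x : ℝ, (monicHermite j * monicHermite k).eval x * Real.exp (-x ^ 2)

/-- The inner products of the monic Hermite polynomials on the half line. -/
noncomputable def halfMoment (j k : ℕ) : ℝ :=
  ∫ x in Ioi (0 : ℝ), (monicHermite j * monicHermite k).eval x * Real.exp (-x ^ 2)

theorem fullMoment_of_ne {j k : ℕ} (h : j ≠ k) : fullMoment j k = 0 := by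
  have h0 := integral_derivative_sub_mul_exp_neg_sq (monicHermite j * derivative (monicHermite k)
        - derivative (monicHermite j) * monicHermite k)
  rw [derivative_wronskian_monicHermite] at h0
  simp only [eval_C_mul, mul_assoc _ (eval _ _) _] at h0
  rw [integral_const_mul] at h0
  have : (j : ℝ) - k ≠ 0 := sub_ne_zero.2 (by exact_mod_cast h)
  simpa [this, fullMoment] using h0

theorem mul_halfMoment (j k : ℕ) :
    2 * ((j : ℝ) - k) * halfMoment j k =
      (derivative (monicHermite j)).eval 0 * (monicHermite k).eval 0
        - (monicHermite j).eval 0 * (derivative (monicHermite k)).eval 0 := by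
  have h0 := integral_Ioi_derivative_sub_mul_exp_neg_sq
    (monicHermite j * derivative (monicHermite k) - derivative (monicHermite j) * monicHermite k)
  rw [derivative_wronskian_monicHermite] at h0
  simp only [eval_C_mul, mul_assoc _ (eval _ _) _] at h0
  rw [integral_const_mul] at h0
  simp only [eval_sub, eval_mul, neg_sub] at h0
  simpa [halfMoment] using h0

theorem fullMoment_succ (k : ℕ) :
    2 * fullMoment (k + 1) (k + 1) = ((k : ℝ) + 1) * fullMoment k k := by
  have h0 := integral_derivative_sub_mul_exp_neg_sq (monicHermite (k + 1) * monicHermite k)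
  rw [derivative_monicHermite_mul_succ] at h0
  simp only [eval_C_mul, eval_sub, sub_mul, mul_assoc _ (eval _ _) _] at h0
  rw [integral_sub ((integrable_eval_mul_exp_neg_sq _).const_mul _)
    ((integrable_eval_mul_exp_neg_sq _).const_mul _), integral_const_mul, integral_const_mul] at h0
  unfold fullMoment
  linarith

theorem eval_zero_monicHermite_succ_succ (k : ℕ) :
    (monicHermite (k + 2)).eval 0 = -(((k : ℝ) + 1) / 2) * (monicHermite k).eval 0 := by
  rw [monicHermite_succ, derivative_monicHermite_succ]
  simp only [eval_sub, eval_mul, eval_X, eval_C, eval_add, eval_natCast, eval_one]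
  ring

theorem eval_zero_monicHermite_odd (m : ℕ) : (monicHermite (2 * m + 1)).eval 0 = 0 := by
  induction m with
  | zero => simp [monicHermite_succ, monicHermite_zero]
  | succ m ih =>
    rw [show 2 * (m + 1) + 1 = 2 * m + 1 + 2 by ring, eval_zero_monicHermite_succ_succ, ih,
      mul_zero]

theorem eval_zero_monicHermite_mul_succ (k : ℕ) :
    (monicHermite (k + 1)).eval 0 * (monicHermite k).eval 0 = 0 := by
  rcases Nat.even_or_odd' k with ⟨m, rfl | rfl⟩ <;> simp [eval_zero_monicHermite_odd]

theorem halfMoment_succ (k : ℕ) :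
    2 * halfMoment (k + 1) (k + 1) = ((k : ℝ) + 1) * halfMoment k k := by
  have h0 := integral_Ioi_derivative_sub_mul_exp_neg_sq (monicHermite (k + 1) * monicHermite k)
  rw [derivative_monicHermite_mul_succ, eval_mul, eval_zero_monicHermite_mul_succ] at h0
  simp only [eval_C_mul, eval_sub, sub_mul, mul_assoc _ (eval _ _) _] at h0
  rw [integral_sub ((integrable_eval_mul_exp_neg_sq _).integrableOn.const_mul _)
    ((integrable_eval_mul_exp_neg_sq _).integrableOn.const_mul _), integral_const_mul,
    integral_const_mul] at h0
  unfold halfMoment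
  linarith

theorem fullMoment_zero : fullMoment 0 0 = √Real.pi := by
  simpa [fullMoment, monicHermite_zero] using integral_gaussian 1

theorem halfMoment_zero : halfMoment 0 0 = √Real.pi / 2 := by
  simpa [halfMoment, monicHermite_zero] using integral_gaussian_Ioi 1

/-- Both sides obey the same recursion in `k`: the boundary term in `halfMoment_succ` drops out
because one of two consecutive Hermite polynomials vanishes at `0`. -/
theorem halfMoment_self (k : ℕ) : halfMoment k k = fullMoment k k / 2 := by
  induction k with
  | zero => rw [halfMoment_zero, fullMoment_zero]
  | succ k ih => linear_combination halfMoment_succ k / 2 - fullMoment_succ k / 4 + (k + 1) / 2 * ih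

theorem fullMoment_self_pos (k : ℕ) : 0 < fullMoment k k := by
  induction k with
  | zero => rw [fullMoment_zero]; positivity
  | succ k ih =>
    have := fullMoment_succ k
    have : 0 < ((k : ℝ) + 1) * fullMoment k k := by positivity
    linarith

theorem halfMoment_comm (j k : ℕ) : halfMoment j k = halfMoment k j := by
  simp only [halfMoment, mul_comm (monicHermite j)]

/-! ### Andréief's identity -/

section Andreief

variable {ι : Type*} [Fintype ι] [DecidableEq ι]

theorem det_mul_det_mul_prod (f g : ι → ℝ → ℝ) (w : ℝ → ℝ) (x : ι → ℝ) :
    (Matrix.of fun i j => f j (x i)).det * (Matrix.of fun i j => g j (x i)).det * ∏ i, w (x i) =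
      ∑ σ : Equiv.Perm ι, ∑ τ : Equiv.Perm ι, ((Equiv.Perm.sign σ : ℤ) : ℝ) *
        ((Equiv.Perm.sign τ : ℤ) : ℝ) * ∏ i, f (σ i) (x i) * g (τ i) (x i) * w (x i) := by
  rw [← Matrix.det_transpose, ← Matrix.det_transpose (Matrix.of fun i j => g j (x i)),
    Matrix.det_apply', Matrix.det_apply', Finset.sum_mul_sum, Finset.sum_mul]
  refine Finset.sum_congr rfl fun σ _ => ?_
  rw [Finset.sum_mul]
  refine Finset.sum_congr rfl fun τ _ => ?_
  simp only [Matrix.transpose_apply, Matrix.of_apply, Finset.prod_mul_distrib]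
  ring

theorem integrable_det_mul_det_mul_prod (f g : ι → ℝ → ℝ) (w : ℝ → ℝ)
    (h : ∀ i j, Integrable fun x => f i x * g j x * w x) :
    Integrable fun x : ι → ℝ => (Matrix.of fun i j => f j (x i)).det *
      (Matrix.of fun i j => g j (x i)).det * ∏ i, w (x i) := by
  simp only [det_mul_det_mul_prod]
  refine integrable_finsetSum _ fun σ _ => integrable_finsetSum _ fun τ _ =>
    Integrable.const_mul ?_ _
  exact Integrable.fintype_prod (f := fun i y => f (σ i) y * g (τ i) y * w y) fun i => h _ _

/-- Andréief's identity. -/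
theorem integral_det_mul_det_mul_prod (f g : ι → ℝ → ℝ) (w : ℝ → ℝ)
    (h : ∀ i j, Integrable fun x => f i x * g j x * w x) :
    ∫ x : ι → ℝ, (Matrix.of fun i j => f j (x i)).det *
      (Matrix.of fun i j => g j (x i)).det * ∏ i, w (x i) =
    (Fintype.card ι).factorial * (Matrix.of fun i j => ∫ x, f i x * g j x * w x).det := by
  simp only [det_mul_det_mul_prod]
  have hp : ∀ σ τ : Equiv.Perm ι,
      Integrable fun x : ι → ℝ => ∏ i, f (σ i) (x i) * g (τ i) (x i) * w (x i) := fun σ τ =>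
    Integrable.fintype_prod (f := fun i y => f (σ i) y * g (τ i) y * w y) fun i => h _ _
  rw [integral_finsetSum _ fun σ _ => integrable_finsetSum _ fun τ _ => (hp σ τ).const_mul _]
  have key : ∀ σ : Equiv.Perm ι, ∫ x : ι → ℝ, ∑ τ : Equiv.Perm ι, ((Equiv.Perm.sign σ : ℤ) : ℝ) *
        ((Equiv.Perm.sign τ : ℤ) : ℝ) * ∏ i, f (σ i) (x i) * g (τ i) (x i) * w (x i) =
      (Matrix.of fun i j => ∫ x, f i x * g j x * w x).det := by
    intro σ
    rw [integral_finsetSum _ fun τ _ => (hp σ τ).const_mul _]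
    -- Permuting the rows by `σ` absorbs `sign σ`, so each of the `n!` outer terms equals the same
    -- determinant.
    have h1 : (Matrix.of fun i j => ∫ x, f i x * g j x * w x).det =
        (Equiv.Perm.sign σ : ℤ) * ((Matrix.of fun i j => ∫ x, f i x * g j x * w x).submatrix
          σ id).transpose.det := by
      rw [Matrix.det_transpose, Matrix.det_permute, ← mul_assoc, ← Int.cast_mul, ← Units.val_mul,
        Int.units_mul_self]
      simp
    rw [h1, Matrix.det_apply', Finset.mul_sum]
    refine Finset.sum_congr rfl fun τ _ => ?_
    rw [integral_const_mul,
      integral_fintype_prod_volume_eq_prod (fun i y => f (σ i) y * g (τ i) y * w y), mul_assoc]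
    rfl
  rw [Finset.sum_congr rfl fun σ _ => key σ, Finset.sum_const, Finset.card_univ,
    Fintype.card_perm, nsmul_eq_mul]

end Andreief

/-! ### The generating function of the index as a determinant -/

theorem weight_eq_det (n : ℕ) (x : Fin n → ℝ) :
    weight n x = (Matrix.of fun i j : Fin n => (monicHermite j).eval (x i)).det *
      (Matrix.of fun i j : Fin n => (monicHermite j).eval (x i)).det *
        ∏ i, Real.exp (-x i ^ 2) := by
  rw [← Matrix.det_eval_matrixOfPolynomials_eq_det_vandermonde x (fun j => monicHermite j)
    (fun j => natDegree_monicHermite j) fun j => monicHermite_monic j, Matrix.det_vandermonde,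
    ← Real.exp_sum, Finset.sum_neg_distrib, weight, mul_comm, ← pow_two, ← Finset.prod_pow]
  simp only [← Finset.prod_pow]
  congr 1
  exact Finset.prod_congr rfl fun j _ => Finset.prod_congr rfl fun k _ => by ring

/-- The factor `(1 + t)^{n₊}` is a product of one-variable functions, so it can be absorbed into the
weight in Andréief's identity. -/
theorem prod_one_add_indicator {n : ℕ} (t : ℝ) (x : Fin n → ℝ) :
    ∏ i, (1 + t * (Ioi (0 : ℝ)).indicator 1 (x i)) = (1 + t) ^ index x := by
  have : ∀ i, 1 + t * (Ioi (0 : ℝ)).indicator 1 (x i) = if 0 < x i then 1 + t else 1 := by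
    intro i
    by_cases h : 0 < x i <;> simp [h, indicator]
  simp only [this, Finset.prod_ite, Finset.prod_const_one, mul_one, Finset.prod_const, index]

theorem integrable_hermite_mul_indicator (t : ℝ) (j k : ℕ) :
    Integrable fun x : ℝ => (monicHermite j).eval x * (monicHermite k).eval x *
      (Real.exp (-x ^ 2) * (1 + t * (Ioi (0 : ℝ)).indicator 1 x)) := by
  have h := integrable_eval_mul_exp_neg_sq (monicHermite j * monicHermite k)
  refine (h.add ((h.indicator (measurableSet_Ioi (a := 0))).const_mul t)).congr (ae_of_all _ fun x => ?_)
  by_cases hx : 0 < x <;> simp [hx, indicator]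
  ring

theorem integral_hermite_mul_indicator (t : ℝ) (j k : ℕ) :
    ∫ x : ℝ, (monicHermite j).eval x * (monicHermite k).eval x *
      (Real.exp (-x ^ 2) * (1 + t * (Ioi (0 : ℝ)).indicator 1 x)) =
    fullMoment j k + t * halfMoment j k := by
  have h := integrable_eval_mul_exp_neg_sq (monicHermite j * monicHermite k)
  rw [fullMoment, halfMoment, ← integral_indicator measurableSet_Ioi, ← integral_const_mul,
    ← integral_add h ((h.indicator measurableSet_Ioi).const_mul t)]
  refine integral_congr_ae (ae_of_all _ fun x => ?_)
  by_cases hx : 0 < x <;> simp [hx, indicator]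
  ring

theorem weight_mul_pow_index (n : ℕ) (t : ℝ) (x : Fin n → ℝ) :
    weight n x * (1 + t) ^ index x =
      (Matrix.of fun i j : Fin n => (monicHermite j).eval (x i)).det *
      (Matrix.of fun i j : Fin n => (monicHermite j).eval (x i)).det *
        ∏ i, (Real.exp (-x i ^ 2) * (1 + t * (Ioi (0 : ℝ)).indicator 1 (x i))) := by
  rw [Finset.prod_mul_distrib, prod_one_add_indicator, weight_eq_det]
  ring

theorem integral_weight_mul_pow_index (n : ℕ) (t : ℝ) :
    ∫ x : Fin n → ℝ, weight n x * (1 + t) ^ index x =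
      n.factorial * (Matrix.of fun i j : Fin n =>
        fullMoment i j + t * halfMoment i j).det := by
  simp only [weight_mul_pow_index]
  have h := integral_det_mul_det_mul_prod (fun (i : Fin n) x => (monicHermite i).eval x)
    (fun (i : Fin n) x => (monicHermite i).eval x)
    (fun x => Real.exp (-x ^ 2) * (1 + t * (Ioi (0 : ℝ)).indicator 1 x))
    fun i j => integrable_hermite_mul_indicator t i j
  simpa only [integral_hermite_mul_indicator, Fintype.card_fin] using h

theorem integrable_weight (n : ℕ) : Integrable (weight n) := by
  have h := integrable_det_mul_det_mul_prod (fun (i : Fin n) x => (monicHermite i).eval x)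
    (fun (i : Fin n) x => (monicHermite i).eval x)
    (fun x => Real.exp (-x ^ 2) * (1 + 0 * (Ioi (0 : ℝ)).indicator 1 x))
    fun i j => integrable_hermite_mul_indicator 0 i j
  simpa only [← weight_mul_pow_index, add_zero, one_pow, mul_one] using h

/-- The compression of the indicator of the half line to the span of the first `n` Hermite
functions, in the basis of monic Hermite polynomials. -/
noncomputable def halfMatrix (n : ℕ) : Matrix (Fin n) (Fin n) ℝ :=
  Matrix.of fun i j => halfMoment i j / fullMoment i i

theorem det_moments (n : ℕ) (t : ℝ) :
    (Matrix.of fun i j : Fin n => fullMoment i j + t * halfMoment i j).det =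
      (∏ i : Fin n, fullMoment i i) * (1 + t • halfMatrix n).det := by
  rw [← Matrix.det_diagonal, ← Matrix.det_mul]
  congr 1
  ext i j
  have hi := (fullMoment_self_pos i).ne'
  rw [Matrix.diagonal_mul, Matrix.add_apply, Matrix.smul_apply, Matrix.of_apply, halfMatrix,
    Matrix.of_apply, smul_eq_mul]
  by_cases hij : i = j
  · subst hij
    rw [Matrix.one_apply_eq]
    field_simp
  · rw [Matrix.one_apply_ne hij, fullMoment_of_ne fun h => hij (Fin.ext h)]
    field_simp
    ring

theorem normalisation_eq (n : ℕ) :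
    normalisation n = n.factorial * ∏ i : Fin n, fullMoment i i := by
  have h := integral_weight_mul_pow_index n 0
  rw [det_moments] at h
  simpa [normalisation] using h

theorem measurableSet_index_eq (n k : ℕ) : MeasurableSet {x : Fin n → ℝ | index x = k} := by
  have : Measurable fun x : Fin n → ℝ => index x := by
    simp only [index, Finset.card_filter]
    exact Finset.measurable_sum _ fun i _ => Measurable.ite
      (measurableSet_lt measurable_const (measurable_pi_apply i)) measurable_const measurable_const
  exact this (measurableSet_singleton k)

theorem index_le {n : ℕ} (x : Fin n → ℝ) : index x ≤ n :=
  (Finset.card_filter_le _ _).trans (by simp)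

theorem integral_weight_mul_pow_index_eq_sum (n : ℕ) (z : ℝ) :
    ∫ x : Fin n → ℝ, weight n x * z ^ index x =
      ∑ k ∈ Finset.range (n + 1), (∫ x in {x : Fin n → ℝ | index x = k}, weight n x) * z ^ k := by
  have h : ∀ x : Fin n → ℝ, weight n x * z ^ index x = ∑ k ∈ Finset.range (n + 1),
      {x : Fin n → ℝ | index x = k}.indicator (weight n) x * z ^ k := by
    intro x
    rw [Finset.sum_eq_single (index x)]
    · simp [indicator]
    · intro k _ hk
      simp [indicator, hk.symm]
    · intro hx
      exact absurd (Finset.mem_range.2 (Nat.lt_succ_of_le (index_le x))) hx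
  simp only [h]
  rw [integral_finsetSum _ fun k _ =>
    ((integrable_weight n).indicator (measurableSet_index_eq n k)).mul_const _]
  refine Finset.sum_congr rfl fun k _ => ?_
  rw [integral_mul_const, integral_indicator (measurableSet_index_eq n k)]

/-- The generating function of the index distribution is a determinant. -/
theorem sum_prob_mul_pow (n : ℕ) (t : ℝ) :
    ∑ k ∈ Finset.range (n + 1), prob k n * (1 + t) ^ k = (1 + t • halfMatrix n).det := by
  have hN : (normalisation n) ≠ 0 := by
    rw [normalisation_eq]
    exact mul_ne_zero (by positivity) (Finset.prod_ne_zero_iff.2 fun i _ =>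
      (fullMoment_self_pos i).ne')
  have h := integral_weight_mul_pow_index_eq_sum n (1 + t)
  rw [integral_weight_mul_pow_index, det_moments, ← mul_assoc, ← normalisation_eq] at h
  simp only [prob, div_mul_eq_mul_div]
  rw [← Finset.sum_div, ← h, mul_div_cancel_left₀ _ hN]

/-! ### The variance as a trace -/

/-- The generating polynomial of the factorial moments of the index. -/
noncomputable def indexPoly (n : ℕ) : ℝ[X] :=
  ∑ k ∈ Finset.range (n + 1), C (prob k n) * (1 + X) ^ k

theorem coeff_indexPoly (n i : ℕ) :
    (indexPoly n).coeff i = ∑ k ∈ Finset.range (n + 1), prob k n * (k.choose i : ℝ) := by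
  simp [indexPoly, coeff_one_add_X_pow]

theorem eval_indexPoly (n : ℕ) (t : ℝ) : (indexPoly n).eval t = (1 + t • halfMatrix n).det := by
  rw [← sum_prob_mul_pow]
  simp [indexPoly, eval_finsetSum]

theorem eval_det_one_add_X_smul {n : ℕ} (A : Matrix (Fin n) (Fin n) ℝ) (t : ℝ) :
    (Matrix.det (1 + (X : ℝ[X]) • A.map C)).eval t = (1 + t • A).det := by
  rw [← coe_evalRingHom, RingHom.map_det]
  congr 1
  ext i j
  by_cases h : i = j <;> simp [h, mul_comm t]

theorem indexPoly_eq_det (n : ℕ) :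
    indexPoly n = Matrix.det (1 + (X : ℝ[X]) • (halfMatrix n).map C) :=
  Polynomial.funext fun t => by rw [eval_indexPoly, eval_det_one_add_X_smul]

/-- This is `det (1 + tA) det (1 - tA) = det (1 - t²A²)`. Comparing coefficients of `t²` yields
Newton's identity for `tr A²` without eigenvalues. -/
theorem indexPoly_mul_comp_neg (n : ℕ) :
    indexPoly n * (indexPoly n).comp (C (-1) * X) = expand ℝ 2
      (Matrix.det (1 + (X : ℝ[X]) • (-(halfMatrix n * halfMatrix n)).map C)) := by
  refine Polynomial.funext fun t => ?_
  rw [expand_eval, eval_det_one_add_X_smul, eval_mul, eval_comp, eval_C_mul, eval_X, neg_one_mul, eval_indexPoly,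
    eval_indexPoly, ← Matrix.det_mul]
  congr 1
  simp only [mul_add, add_mul, one_mul, mul_one, neg_smul, smul_neg, mul_neg, Matrix.smul_mul,
    Matrix.mul_smul, smul_smul, pow_two]
  abel

theorem coeff_indexPoly_zero (n : ℕ) : (indexPoly n).coeff 0 = 1 := by
  rw [coeff_zero_eq_eval_zero, eval_indexPoly]
  simp

theorem coeff_indexPoly_one (n : ℕ) : (indexPoly n).coeff 1 = (halfMatrix n).trace := by
  rw [indexPoly_eq_det, Matrix.coeff_det_one_add_X_smul_one]

theorem coeff_indexPoly_two (n : ℕ) :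
    2 * (indexPoly n).coeff 2 - (indexPoly n).coeff 1 ^ 2 =
      -(halfMatrix n * halfMatrix n).trace := by
  have h := congrArg (fun p => coeff p (1 * 2)) (indexPoly_mul_comp_neg n)
  simp only [coeff_expand_mul two_pos, Matrix.coeff_det_one_add_X_smul_one] at h
  rw [Matrix.trace_neg] at h
  rw [← h, coeff_mul]
  simp only [comp_C_mul_X_coeff, one_mul, Finset.Nat.antidiagonal_succ]
  simp [coeff_indexPoly_zero]
  ring

theorem variance_eq_trace (n : ℕ) :
    variance n = (halfMatrix n).trace - (halfMatrix n * halfMatrix n).trace := by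
  have h0 := coeff_indexPoly n 0
  have h1 := coeff_indexPoly n 1
  have h2 := coeff_indexPoly n 2
  have h12 := coeff_indexPoly_two n
  rw [coeff_indexPoly_zero] at h0
  have hm : mean n = (indexPoly n).coeff 1 := by
    rw [h1, mean]
    exact Finset.sum_congr rfl fun k _ => by simp [mul_comm]
  -- Expand `(k - μ)²` in the binomials `k choose i`, whose means are the coefficients of
  -- `indexPoly`.
  have hv : variance n = ∑ k ∈ Finset.range (n + 1), (2 * (prob k n * (k.choose 2 : ℝ))
      + (1 - 2 * mean n) * (prob k n * (k.choose 1 : ℝ))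
      + mean n ^ 2 * (prob k n * (k.choose 0 : ℝ))) := by
    rw [variance]
    refine Finset.sum_congr rfl fun k _ => ?_
    rw [Nat.cast_choose_two, Nat.choose_one_right, Nat.choose_zero_right]
    push_cast
    ring
  rw [hv, Finset.sum_add_distrib, Finset.sum_add_distrib, ← Finset.mul_sum, ← Finset.mul_sum,
    ← Finset.mul_sum, ← h0, ← h1, ← h2, hm, ← coeff_indexPoly_one]
  linear_combination h12

/-! ### Overlaps and their closed form -/

/-- The squared matrix entries in the orthonormal basis. -/
noncomputable def overlapSq (j k : ℕ) : ℝ :=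
  halfMoment j k ^ 2 / (fullMoment j j * fullMoment k k)

theorem variance_eq_sum (n : ℕ) :
    variance n = (n : ℝ) / 2 - ∑ j ∈ Finset.range n, ∑ k ∈ Finset.range n, overlapSq j k := by
  rw [variance_eq_trace]
  congr 1
  · simp only [Matrix.trace, Matrix.diag_apply, halfMatrix, Matrix.of_apply, halfMoment_self]
    rw [Finset.sum_congr rfl fun (i : Fin n) _ =>
      show fullMoment i i / 2 / fullMoment i i = 1 / 2 by
        have := (fullMoment_self_pos i).ne'
        field_simp]
    simp
    ring
  · simp only [Matrix.trace, Matrix.diag_apply, halfMatrix, Matrix.mul_apply, Matrix.of_apply]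
    rw [Finset.sum_range]
    refine Finset.sum_congr rfl fun j _ => ?_
    rw [Finset.sum_range]
    refine Finset.sum_congr rfl fun k _ => ?_
    rw [halfMoment_comm k j, overlapSq, div_mul_div_comm, pow_two]

theorem overlapSq_comm (j k : ℕ) : overlapSq j k = overlapSq k j := by
  rw [overlapSq, overlapSq, halfMoment_comm, mul_comm (fullMoment j j)]

theorem overlapSq_self (k : ℕ) : overlapSq k k = 1 / 4 := by
  have := (fullMoment_self_pos k).ne'
  rw [overlapSq, halfMoment_self]
  field_simp
  norm_num

theorem variance_succ (n : ℕ) :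
    variance (n + 1) = variance n + 1 / 4 - 2 * ∑ j ∈ Finset.range n, overlapSq j n := by
  rw [variance_eq_sum, variance_eq_sum, Finset.sum_range_succ]
  simp only [Finset.sum_range_succ, Finset.sum_add_distrib, overlapSq_self, overlapSq_comm n]
  push_cast
  ring

/-- The normalised central binomial coefficient `4⁻ᵐ (2m choose m)`. -/
noncomputable def centralWeight (m : ℕ) : ℝ := (m.centralBinom : ℝ) / 4 ^ m

theorem centralWeight_zero : centralWeight 0 = 1 := by simp [centralWeight]

theorem centralWeight_succ (m : ℕ) :
    2 * ((m : ℝ) + 1) * centralWeight (m + 1) = (2 * m + 1) * centralWeight m := by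
  have h : ((m : ℝ) + 1) * (m + 1).centralBinom = 2 * (2 * m + 1) * m.centralBinom := by
    exact_mod_cast Nat.succ_mul_centralBinom_succ m
  rw [centralWeight, centralWeight, pow_succ]
  field_simp
  linear_combination 2 * h

theorem Gamma_add_half_div_Gamma (m : ℕ) :
    Real.Gamma ((m : ℝ) + 1 / 2) / Real.Gamma ((m : ℝ) + 1) = √Real.pi * centralWeight m := by
  induction m with
  | zero => simp [centralWeight_zero, -one_div, Real.Gamma_one_half_eq]
  | succ m ih =>
    have h1 : Real.Gamma ((m : ℝ) + 1) ≠ 0 := (Real.Gamma_pos_of_pos (by positivity)).ne'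
    have hm : (m : ℝ) + 1 ≠ 0 := by positivity
    push_cast
    rw [show (m : ℝ) + 1 + 1 / 2 = (m + 1 / 2) + 1 by ring, Real.Gamma_add_one (by positivity),
      Real.Gamma_add_one hm, mul_div_mul_comm, ih]
    field_simp
    linear_combination -centralWeight_succ m

/-- Passing from `p` to `p + 1` multiplies both sides by `(2p + 1)/(2p + 2)`. -/
theorem sq_eval_zero_div_fullMoment (p : ℕ) :
    (monicHermite (2 * p)).eval 0 ^ 2 / fullMoment (2 * p) (2 * p) =
      centralWeight p / √Real.pi := by
  have hpi : √Real.pi ≠ 0 := by positivity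
  induction p with
  | zero => simp [monicHermite_zero, fullMoment_zero, centralWeight_zero]
  | succ p ih =>
    have h0 := (fullMoment_self_pos (2 * p)).ne'
    have h2 := (fullMoment_self_pos (2 * p + 2)).ne'
    have e1 := fullMoment_succ (2 * p)
    have e2 := fullMoment_succ (2 * p + 1)
    have hc := centralWeight_succ p
    push_cast at e1 e2
    have e3 : fullMoment (2 * p + 2) (2 * p + 2) =
        (p + 1) * (2 * p + 1) / 2 * fullMoment (2 * p) (2 * p) := by
      linear_combination e2 / 2 + (2 * p + 2) / 4 * e1
    have hc' : centralWeight (p + 1) = (2 * p + 1) / (2 * (p + 1)) * centralWeight p := by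
      field_simp
      linear_combination hc
    rw [show 2 * (p + 1) = 2 * p + 2 by ring, eval_zero_monicHermite_succ_succ, e3, hc', mul_pow,
      mul_div_assoc (_ / _), ← ih]
    push_cast
    have : (2 * (p : ℝ) + 1) ≠ 0 := by positivity
    field_simp

theorem eval_zero_derivative_even (p : ℕ) : (derivative (monicHermite (2 * p))).eval 0 = 0 := by
  cases p with
  | zero => simp [monicHermite_zero]
  | succ p =>
    rw [show 2 * (p + 1) = 2 * p + 1 + 1 by ring, derivative_monicHermite_succ, eval_mul,
      eval_zero_monicHermite_odd, mul_zero]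

theorem overlapSq_even_even {p q : ℕ} (h : p ≠ q) : overlapSq (2 * p) (2 * q) = 0 := by
  have h0 := mul_halfMoment (2 * p) (2 * q)
  rw [eval_zero_derivative_even, eval_zero_derivative_even] at h0
  have h1 : (((2 * p : ℕ) : ℝ) - (2 * q : ℕ)) ≠ 0 := sub_ne_zero.2 (by norm_cast; omega)
  have h2 : halfMoment (2 * p) (2 * q) = 0 := by simpa [h1, sub_eq_zero, h] using h0
  simp [overlapSq, h2]

theorem overlapSq_odd_odd {p q : ℕ} (h : p ≠ q) : overlapSq (2 * p + 1) (2 * q + 1) = 0 := by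
  have h0 := mul_halfMoment (2 * p + 1) (2 * q + 1)
  rw [eval_zero_monicHermite_odd, eval_zero_monicHermite_odd] at h0
  have h2 : halfMoment (2 * p + 1) (2 * q + 1) = 0 := by simpa [sub_eq_zero, h] using h0
  simp [overlapSq, h2]

theorem overlapSq_even_odd (p q : ℕ) :
    overlapSq (2 * p) (2 * q + 1) = (2 * q + 1) * centralWeight p * centralWeight q /
      (2 * Real.pi * (2 * ((q : ℝ) - p) + 1) ^ 2) := by
  have h0 := mul_halfMoment (2 * p) (2 * q + 1)
  rw [eval_zero_derivative_even, derivative_monicHermite_succ] at h0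
  have hd : (2 * ((q : ℝ) - p) + 1) ≠ 0 := by
    have : (2 * ((q : ℤ) - p) + 1) ≠ 0 := by omega
    exact_mod_cast this
  simp only [eval_mul, eval_add, eval_natCast, eval_one] at h0
  push_cast at h0
  have hJ : halfMoment (2 * p) (2 * q + 1) = (2 * q + 1) * (monicHermite (2 * p)).eval 0 *
      (monicHermite (2 * q)).eval 0 / (2 * (2 * ((q : ℝ) - p) + 1)) := by
    rw [eq_div_iff (by simpa using hd)]
    linear_combination (-1) * h0
  have hp := (fullMoment_self_pos (2 * p)).ne'
  have hq := (fullMoment_self_pos (2 * q)).ne'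
  have e1 := fullMoment_succ (2 * q)
  push_cast at e1
  have e1' : fullMoment (2 * q + 1) (2 * q + 1) =
      (2 * q + 1) / 2 * fullMoment (2 * q) (2 * q) := by linear_combination e1 / 2
  have hpi : √Real.pi * √Real.pi = Real.pi := Real.mul_self_sqrt Real.pi_pos.le
  have key : overlapSq (2 * p) (2 * q + 1) = (2 * q + 1) *
      ((monicHermite (2 * p)).eval 0 ^ 2 / fullMoment (2 * p) (2 * p)) *
      ((monicHermite (2 * q)).eval 0 ^ 2 / fullMoment (2 * q) (2 * q)) /
      (2 * (2 * ((q : ℝ) - p) + 1) ^ 2) := by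
    rw [overlapSq, hJ, e1']
    have : (2 * (q : ℝ) + 1) ≠ 0 := by positivity
    field_simp
  rw [key, sq_eval_zero_div_fullMoment, sq_eval_zero_div_fullMoment]
  have : √Real.pi ≠ 0 := by positivity
  generalize √Real.pi = s at *
  rw [← hpi]
  field_simp

theorem sum_range_two_mul {M : Type*} [AddCommMonoid M] (f : ℕ → M) (m : ℕ) :
    ∑ i ∈ Finset.range (2 * m), f i =
      ∑ p ∈ Finset.range m, f (2 * p) + ∑ p ∈ Finset.range m, f (2 * p + 1) := by
  induction m with
  | zero => simp
  | succ m ih =>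
    rw [show 2 * (m + 1) = 2 * m + 1 + 1 by ring, Finset.sum_range_succ, Finset.sum_range_succ, ih,
      Finset.sum_range_succ, Finset.sum_range_succ]
    abel

/-! ### Recurrences for the two sums -/

/-- The convolution `∑ p ≤ m, cₚ / (2 (m - p) + 1) ^ 2` of the normalised central binomials. -/
noncomputable def evenSum (m : ℕ) : ℝ :=
  ∑ p ∈ Finset.range (m + 1), centralWeight p / (2 * ((m : ℝ) - p) + 1) ^ 2

/-- The companion `∑ q < m, (2 q + 1) c_q / (2 (m - q) - 1) ^ 2` of `evenSum`. -/
noncomputable def oddSum (m : ℕ) : ℝ :=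
  ∑ q ∈ Finset.range m, (2 * (q : ℝ) + 1) * centralWeight q / (2 * ((m : ℝ) - q) - 1) ^ 2

theorem sum_overlapSq_even (m : ℕ) :
    2 * ∑ j ∈ Finset.range (2 * m), overlapSq j (2 * m) =
      centralWeight m * oddSum m / Real.pi := by
  rw [sum_range_two_mul, Finset.sum_eq_zero fun p hp =>
    overlapSq_even_even (Finset.mem_range.1 hp).ne, zero_add, oddSum, Finset.mul_sum,
    Finset.mul_sum, Finset.sum_div]
  refine Finset.sum_congr rfl fun q _ => ?_
  rw [overlapSq_comm, overlapSq_even_odd,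
    show (2 * ((q : ℝ) - m) + 1) ^ 2 = (2 * ((m : ℝ) - q) - 1) ^ 2 by ring]
  field_simp

theorem sum_overlapSq_odd (m : ℕ) :
    2 * ∑ j ∈ Finset.range (2 * m + 1), overlapSq j (2 * m + 1) =
      (2 * m + 1) * centralWeight m * evenSum m / Real.pi := by
  rw [Finset.sum_range_succ, sum_range_two_mul, Finset.sum_eq_zero (f := fun p =>
    overlapSq (2 * p + 1) (2 * m + 1)) fun p hp =>
    overlapSq_odd_odd (Finset.mem_range.1 hp).ne, add_zero,
    ← Finset.sum_range_succ fun p => overlapSq (2 * p) (2 * m + 1), evenSum, Finset.mul_sum,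
    Finset.mul_sum, Finset.sum_div]
  refine Finset.sum_congr rfl fun p _ => ?_
  rw [overlapSq_even_odd]
  field_simp

theorem two_mul_sub_add_one_ne_zero {m p : ℕ} : (2 * ((m : ℝ) - p) + 1) ≠ 0 := by
  have : (2 * ((m : ℤ) - p) + 1) ≠ 0 := by omega
  exact_mod_cast this

/-- Split `(2q + 1) c_q = c_q + 2q c_q`; since `2q c_q = (2q - 1) c_{q-1}`, the second part is
`oddSum m` with its index shifted. -/
theorem oddSum_succ (m : ℕ) : oddSum (m + 1) = evenSum m + oddSum m := by
  have h1 : oddSum (m + 1) = evenSum m + ∑ q ∈ Finset.range (m + 1),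
      2 * (q : ℝ) * centralWeight q / (2 * ((m : ℝ) - q) + 1) ^ 2 := by
    rw [oddSum, evenSum, ← Finset.sum_add_distrib]
    refine Finset.sum_congr rfl fun q _ => ?_
    push_cast
    rw [show (2 * ((m : ℝ) + 1 - q) - 1) = 2 * ((m : ℝ) - q) + 1 by ring]
    ring
  rw [h1, Finset.sum_range_succ', oddSum]
  simp only [Nat.cast_zero, mul_zero, zero_mul, zero_div, add_zero]
  congr 1
  refine Finset.sum_congr rfl fun q _ => ?_
  push_cast
  rw [centralWeight_succ, show (2 * ((m : ℝ) - (q + 1)) + 1) = 2 * ((m : ℝ) - q) - 1 by ring]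

theorem evenSum_succ (m : ℕ) :
    (2 * ((m : ℝ) + 1) + 1) ^ 2 * evenSum (m + 1) - oddSum (m + 1)
      - 4 * ((m : ℝ) + 1) ^ 2 * evenSum m = centralWeight (m + 1) := by
  -- A telescoping certificate for the combined summand, with `G 0 = 0`. The `p = m + 1` term of
  -- `evenSum (m + 1)` remains, and subtracting `G (m + 1)` leaves the coefficient `(2a + 1)² - 4a -
  -- 4a² = 1`, where `a = m + 1`.
  let G : ℕ → ℝ := fun p => 4 * p * centralWeight p / (2 * ((m : ℝ) + 1 - p) + 1)
    + 4 * p ^ 2 * centralWeight p / (2 * ((m : ℝ) + 1 - p) + 1) ^ 2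
  have hG : ∀ p : ℕ, (2 * ((m : ℝ) + 1) + 1) ^ 2 *
      (centralWeight p / (2 * (((m + 1 : ℕ) : ℝ) - p) + 1) ^ 2)
      - (2 * (p : ℝ) + 1) * centralWeight p / (2 * (((m + 1 : ℕ) : ℝ) - p) - 1) ^ 2
      - 4 * ((m : ℝ) + 1) ^ 2 * (centralWeight p / (2 * ((m : ℝ) - p) + 1) ^ 2)
      = -(G (p + 1) - G p) := by
    intro p
    have hc := centralWeight_succ p
    have hc' : centralWeight (p + 1) = (2 * p + 1) / (2 * (p + 1)) * centralWeight p := by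
      field_simp
      linear_combination hc
    have h1 := two_mul_sub_add_one_ne_zero (m := m + 1) (p := p)
    have h2 := two_mul_sub_add_one_ne_zero (m := m) (p := p)
    simp only [G, hc']
    push_cast at h1 ⊢
    rw [show (2 * ((m : ℝ) + 1 - p) - 1) = 2 * ((m : ℝ) - p) + 1 by ring,
      show (2 * ((m : ℝ) + 1 - (p + 1)) + 1) = 2 * ((m : ℝ) - p) + 1 by ring]
    -- Eliminating `m` in favour of `d = 2(m - p) + 1` leaves only the denominators `d` and `d + 2`
    -- from the sums.
    have hm : (m : ℝ) = ((2 * ((m : ℝ) - p) + 1) + 2 * p - 1) / 2 := by ring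
    generalize 2 * ((m : ℝ) - p) + 1 = d at *
    rw [show (2 * ((m : ℝ) + 1 - p) + 1) = d + 2 by rw [hm]; ring] at h1 ⊢
    rw [hm]
    field_simp
    ring
  have hsum := Finset.sum_congr (rfl : Finset.range (m + 1) = _) fun p _ => hG p
  rw [Finset.sum_sub_distrib, Finset.sum_sub_distrib, ← Finset.mul_sum, ← Finset.mul_sum,
    Finset.sum_neg_distrib, Finset.sum_range_sub] at hsum
  rw [evenSum, Finset.sum_range_succ, oddSum, evenSum]
  simp only [G] at hsum
  push_cast at hsum ⊢
  simp only [sub_self, mul_zero, zero_add, div_one, one_pow, zero_mul, zero_div] at hsum ⊢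
  linear_combination hsum

/-! ### The difference equation -/

theorem variance_even_succ (m : ℕ) : variance (2 * m + 1) =
    variance (2 * m) + 1 / 4 - centralWeight m * oddSum m / Real.pi := by
  rw [variance_succ, sum_overlapSq_even]

theorem variance_odd_succ (m : ℕ) : variance (2 * m + 2) =
    variance (2 * m + 1) + 1 / 4 - (2 * m + 1) * centralWeight m * evenSum m / Real.pi := by
  rw [variance_succ, sum_overlapSq_odd]

theorem inhomogeneousTerm_even (m : ℕ) : inhomogeneousTerm (2 * (m + 1)) = 0 := by
  have e1 := variance_even_succ (m + 1)
  have e2 := variance_odd_succ m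
  have e3 := variance_even_succ m
  rw [inhomogeneousTerm, show 2 * (m + 1) - 1 = 2 * m + 1 by omega,
    show 2 * (m + 1) - 2 = 2 * m by omega, e1]
  rw [show 2 * (m + 1) = 2 * m + 2 by ring, e2, e3, oddSum_succ]
  have hc := centralWeight_succ m
  push_cast
  linear_combination (-(evenSum m + oddSum m) / Real.pi) * hc

theorem inhomogeneousTerm_odd (m : ℕ) :
    inhomogeneousTerm (2 * m + 1) = -(centralWeight m ^ 2 / Real.pi) := by
  cases m with
  | zero =>
    have e0 : variance 0 = 0 := by simp [variance_eq_sum]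
    have e1 : variance 1 = _ := variance_even_succ 0
    have e2 : variance 2 = _ := variance_odd_succ 0
    rw [inhomogeneousTerm]
    norm_num
    rw [e2, e1]
    simp [oddSum, evenSum, centralWeight_zero, e0]
    ring
  | succ m =>
    have e1 := variance_odd_succ (m + 1)
    have e2 := variance_even_succ (m + 1)
    have e3 := variance_odd_succ m
    have hc := centralWeight_succ m
    have hE := evenSum_succ m
    rw [inhomogeneousTerm, show 2 * (m + 1) + 1 + 1 = 2 * (m + 1) + 2 by omega,
      show 2 * (m + 1) + 1 - 1 = 2 * (m + 1) by omega,
      show 2 * (m + 1) + 1 - 2 = 2 * m + 1 by omega, e1, e2]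
    rw [show 2 * (m + 1) = 2 * m + 2 by ring, e3]
    push_cast
    linear_combination (-centralWeight (m + 1) / Real.pi) * hE
      - (2 * (m + 1) * evenSum m / Real.pi) * hc

end GUEIndex

theorem mainTheorem6 :
    (∀ n : ℕ, 2 ≤ n →
      (n : ℝ) * GUEIndex.variance (n + 1) - ((n : ℝ) + 1) * GUEIndex.variance n
          - ((n : ℝ) - 2) * GUEIndex.variance (n - 1)
          + ((n : ℝ) - 1) * GUEIndex.variance (n - 2)
        = (1 - (-1 : ℝ) ^ n) / 2 * GUEIndex.inhomogeneousTerm n) ∧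
    (∀ m : ℕ, GUEIndex.inhomogeneousTerm (2 * m + 1) =
      -(1 / Real.pi ^ 2) *
        (Real.Gamma ((m : ℝ) + 1 / 2) ^ 2 / Real.Gamma ((m : ℝ) + 1) ^ 2)) := by
  refine ⟨fun n hn => ?_, fun m => ?_⟩
  · rw [← GUEIndex.inhomogeneousTerm]
    rcases Nat.even_or_odd' n with ⟨m, rfl | rfl⟩
    · obtain ⟨k, rfl⟩ : ∃ k, m = k + 1 := ⟨m - 1, by omega⟩
      rw [GUEIndex.inhomogeneousTerm_even, mul_zero]
    · rw [pow_succ, pow_mul]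
      norm_num
  · rw [GUEIndex.inhomogeneousTerm_odd, ← div_pow, GUEIndex.Gamma_add_half_div_Gamma, mul_pow,
      Real.sq_sqrt Real.pi_pos.le]
    field_simp
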